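/- Let $\Omega\subset\mathbb R^2$ be a bounded open set whose closure $\overline\Omega$ is convex (for instance a bounded convex open set), let $f\in L^1(\Omega)$ with $f\ge 0$ a.e., and let $\Lambda>0$. Let $\mathcal K$ be the family of nonempty closed connected sets $K\subset\overline\Omega$, let $\mathrm{dist}$ be the Euclidean distance and $\mathcal H^1$ the one-dimensional Hausdorff measure. Let $\mathcal M^2(\overline\Omega)$ be the space of finite $\mathbb R^2$-valued Borel measures $v$ on $\overline\Omega$, with total variation $|v|(\overline\Omega)$, and let $\mathcal A_\infty$ be the set of pairs $(K,v)$ with $K\in\mathcal K$, $v\in\mathcal M^2(\overline\Omega)$ and $$\int_{\overline\Omega}\nabla\psi\cdot dv=\int_\Omega \psi f\,dx\qquad\text{for all }\psi\in C^1(\overline\Omega)\text{ with }\psi=0\text{ on }K,$$ where $C^1(\overline\Omega)$ denotes the restrictions to $\overline\Omega$ of $C^1$ functions on $\mathbb R^2$ (this is the weak form of $-\mathrm{div}\,v=f$ in $\Omega\setminus K$, $v\cdot n_\Omega=0$ on $\partial\Omega\setminus K$). Consider the problems $$(P)\quad \inf_{K\in\mathcal K}\left\{\int_\Omega \mathrm{dist}(x,K)f(x)\,dx+\Lambda\mathcal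 H^1(K)\right\},\qquad (Q)\quad \inf_{(K,v)\in\mathcal A_\infty}\left\{|v|(\overline\Omega)+\Lambda\mathcal H^1(K)\right\}.$$ Then $(P)$ and $(Q)$ are equivalent, in the following sense. 1. For every $K\in\mathcal K$, $\int_\Omega\mathrm{dist}(x,K)f(x)\,dx=\min\{|v|(\overline\Omega): (K,v)\in\mathcal A_\infty\}$, and the minimum is attained. 2. The infima in $(P)$ and $(Q)$ are equal. 3. A set $K$ is a minimizer of $(P)$ if and only if there is $v$ such that $(K,v)$ is a minimizer of $(Q)$. 4. A pair $(K,v)$ is a minimizer of $(Q)$ if and only if $K$ is a minimizer of $(P)$, $(K,v)\in\mathcal A_\infty$ and $|v|(\overline\Omega)=\int_\Omega\mathrm{dist}(x,K)f(x)\,dx$. -/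

import Mathlib

open MeasureTheory Set

noncomputable section

/-- The Euclidean plane. -/
abbrev Plane : Type := EuclideanSpace ℝ (Fin 2)

/-- The class of competitors: nonempty closed connected subsets of the closure of `Ω`. -/
def competitors (Ω : Set Plane) : Set (Set Plane) :=
  {K | K ⊆ closure Ω ∧ IsClosed K ∧ IsConnected K}

/-- `∫_Ω dist(x, K) f(x) dx`, as an extended nonnegative number (used for `f ≥ 0`, `K ≠ ∅`). -/
def avgDist (Ω : Set Plane) (f : Plane → ℝ) (K : Set Plane) : ENNReal :=
  ∫⁻ x in Ω, ENNReal.ofReal (Metric.infDist x K * f x)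

/-- The objective of the average-distance problem, `∫_Ω dist(x, K) f(x) dx + Λ H¹(K)`. -/
def avgDistEnergy (Ω : Set Plane) (f : Plane → ℝ) (Λ : ℝ) (K : Set Plane) : ENNReal :=
  avgDist Ω f K + ENNReal.ofReal Λ * Measure.hausdorffMeasure 1 K

/-- `v` is a finite vector measure on the closure of `Ω`: a vector measure on the plane with
finite total variation, all of which is carried by the closure of `Ω`. -/
def IsFiniteOnClosure (Ω : Set Plane) (v : VectorMeasure Plane Plane) : Prop :=
  v.variation univ < ⊤ ∧ v.variation (closure Ω)ᶜ = 0

/-- The pairing `∫ ∇ψ · dv`: the integral of the differential of `ψ` against the vector measure,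
paired through evaluation, `dψ(x)[w] = ∇ψ(x) · w`. -/
def gradPairing (ψ : Plane → ℝ) (v : VectorMeasure Plane Plane) : ℝ :=
  v.integral (fun x => fderiv ℝ ψ x) (ContinuousLinearMap.id ℝ (Plane →L[ℝ] ℝ))

/-- The admissible pairs `(K, v)`: `K` is a competitor, `v` is a finite vector measure on the
closure of `Ω`, and `-div v = f` away from `K` with vanishing normal component on `∂Ω \ K`, in the
weak sense: `∫ ∇ψ · dv = ∫_Ω ψ f` for all `C¹` functions `ψ` vanishing on `K`. (The space
`C¹(closure Ω)` consists of the restrictions of `C¹` functions on the plane.) -/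
def admissiblePairs (Ω : Set Plane) (f : Plane → ℝ) :
    Set (Set Plane × VectorMeasure Plane Plane) :=
  {p | p.1 ∈ competitors Ω ∧ IsFiniteOnClosure Ω p.2 ∧
    ∀ ψ : Plane → ℝ, ContDiff ℝ 1 ψ → (∀ x ∈ p.1, ψ x = 0) →
      gradPairing ψ p.2 = ∫ x in Ω, ψ x * f x}

/-- The objective of the dual problem, `|v|(closure Ω) + Λ H¹(K)`. -/
def beckmannEnergy (Ω : Set Plane) (Λ : ℝ) (p : Set Plane × VectorMeasure Plane Plane) : ENNReal :=
  p.2.variation (closure Ω) + ENNReal.ofReal Λ * Measure.hausdorffMeasure 1 p.1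

/-- `x` is a minimizer of `F` over `S`. -/
def IsMinimizerOn {α : Type*} (F : α → ENNReal) (S : Set α) (x : α) : Prop :=
  x ∈ S ∧ ∀ y ∈ S, F x ≤ F y

end

/-!
For a fixed set `K`, the average distance is the least total variation of an admissible vector
measure; the equivalence of the two problems follows formally, by adding the length term and
cancelling it where it is finite (`hausdorffMeasure_lt_top_of_isMinimizerOn`).

Lower bound (`avgDist_le_variation`): pairing `v` with a potential `ψ` that is 1-Lipschitz and zero
on `K` gives `∫ ψ f ≤ |v|`. The distance `d` to `K` would be the optimal potential, but it is not
`C¹`; a mollification of `(d - ε)⁺` at scale `ε` is, still vanishes on `K`, and is within `2 ε` of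
`d` from below (`exists_contDiff_lipschitz_near`).

Attainment (`segmentFlow`): move each mass element `f(x) dx` along the segment from `x` to a nearest
point `p(x)` of `K`. The segments stay in the convex set `closure Ω`, the total variation is at most
`∫ |x - p(x)| f(x) dx`, and the fundamental theorem of calculus along the segments gives
`∫ ∇ψ · dv = ∫ (ψ(x) - ψ(p(x))) f(x) dx` (`gradPairing_segmentFlow`). The integral against a vector
measure with density is computed by `integral_withDensityᵥ`. A measurable choice of `p` comes
from Rademacher's theorem: the distance to `K` is differentiable almost everywhere, and there
`p(x) = x - d(x) ∇d(x)` (`ae_nearestPoint_mem`).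
-/

/-! ### Nearest points and smooth approximation of the distance -/

/-- Where the distance `d` to `K` is differentiable, `d ∇d` is the displacement from any nearest
point `p`: the distance decreases at unit speed from `x` towards `p` and has gradient of norm at
most `1`, so this is the equality case of the Cauchy-Schwarz inequality. -/
theorem infDist_smul_gradient_infDist {E : Type*} [NormedAddCommGroup E] [InnerProductSpace ℝ E]
    [CompleteSpace E] {K : Set E} {x p : E} (hp : p ∈ K) (hxp : Metric.infDist x K = dist x p)
    (hd : DifferentiableAt ℝ (fun y => Metric.infDist y K) x) :
    Metric.infDist x K • gradient (fun y => Metric.infDist y K) x = x - p := by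
  set d : E → ℝ := fun y => Metric.infDist y K with hdef
  have hdx : d x = ‖x - p‖ := by rw [hdef, ← dist_eq_norm]; exact hxp
  -- The distance is affine along the segment from `p` to `x`.
  have hseg : ∀ t ∈ Icc (0 : ℝ) 1, d (x - t • (x - p)) = (1 - t) * ‖x - p‖ := by
    intro t ht
    apply le_antisymm
    · refine (Metric.infDist_le_dist_of_mem hp).trans_eq ?_
      rw [dist_eq_norm, show x - t • (x - p) - p = (1 - t) • (x - p) by module, norm_smul,
        Real.norm_of_nonneg (by linarith [ht.2])]
    · have h := Metric.infDist_le_infDist_add_dist (s := K) (x := x) (y := x - t • (x - p))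
      rw [dist_eq_norm, sub_sub_cancel, norm_smul, Real.norm_of_nonneg ht.1] at h
      have : ‖x - p‖ ≤ d (x - t • (x - p)) + t * ‖x - p‖ := hdx ▸ h
      linarith
  have hderiv : HasDerivAt (fun t : ℝ => d (x - t • (x - p))) (-(fderiv ℝ d x (x - p))) 0 := by
    have h1 : HasDerivAt (fun t : ℝ => x - t • (x - p)) (-(x - p)) 0 := by
      simpa using ((hasDerivAt_id (0 : ℝ)).smul_const (x - p)).const_sub x
    have h2 : HasFDerivAt d (fderiv ℝ d x) (x - (0 : ℝ) • (x - p)) := by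
      simpa using hd.hasFDerivAt
    simpa [Function.comp_def] using h2.comp_hasDerivAt (0 : ℝ) h1
  have hderiv' : HasDerivWithinAt (fun t : ℝ => d (x - t • (x - p))) (-‖x - p‖) (Icc 0 1) 0 := by
    have : HasDerivWithinAt (fun t : ℝ => (1 - t) * ‖x - p‖) (-‖x - p‖) (Icc 0 1) 0 := by
      simpa using (((hasDerivAt_id (0 : ℝ)).const_sub 1).mul_const ‖x - p‖).hasDerivWithinAt
    exact this.congr hseg (hseg 0 (by simp))
  have heq : fderiv ℝ d x (x - p) = ‖x - p‖ := by
    have := (uniqueDiffOn_Icc (zero_lt_one' ℝ) 0 (by simp)).eq_deriv _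
      hderiv.hasDerivWithinAt hderiv'
    linarith
  have hin : inner ℝ (gradient d x) (x - p) = ‖x - p‖ := by
    rw [← heq, gradient, InnerProductSpace.toDual_symm_apply]
  have hn : ‖gradient d x‖ ≤ 1 := by
    rw [gradient, LinearIsometryEquiv.norm_map]
    simpa using norm_fderiv_le_of_lipschitz ℝ (Metric.lipschitz_infDist_pt K) (x₀ := x)
  change d x • gradient d x = x - p
  rw [hdx, ← sub_eq_zero, ← norm_eq_zero, ← sq_eq_zero_iff]
  refine le_antisymm ?_ (sq_nonneg _)
  rw [norm_sub_sq_real, inner_smul_left, hin, norm_smul]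
  simp only [norm_norm, conj_trivial]
  nlinarith [mul_nonneg (sq_nonneg ‖x - p‖) (sub_nonneg.2 hn), norm_nonneg (gradient d x),
    mul_nonneg (sq_nonneg ‖x - p‖) (mul_nonneg (sub_nonneg.2 hn) (norm_nonneg (gradient d x)))]

/-- The point of `K` nearest to `x`, given by the formula `x - d(x) ∇d(x)` with `d` the distance to
`K`. The formula makes it a measurable function of `x`; where `d` is not differentiable, the junk
value `0` of the gradient makes it `x` itself. -/
noncomputable def nearestPoint {E : Type*} [NormedAddCommGroup E] [InnerProductSpace ℝ E]
    [CompleteSpace E] (K : Set E) (x : E) : E :=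
  x - Metric.infDist x K • gradient (fun y => Metric.infDist y K) x

section
variable {E : Type*} [NormedAddCommGroup E] [InnerProductSpace ℝ E] [FiniteDimensional ℝ E]
  [MeasurableSpace E] [BorelSpace E]

theorem measurable_nearestPoint (K : Set E) : Measurable (nearestPoint K) := by
  have h : Measurable (gradient fun y => Metric.infDist y K) :=
    (InnerProductSpace.toDual ℝ E).symm.continuous.measurable.comp (measurable_fderiv ℝ _)
  have h' : Measurable fun y => Metric.infDist y K := (Metric.continuous_infDist_pt K).measurable
  exact measurable_id.sub (h'.smul h)

theorem ae_nearestPoint_mem (μ : Measure E) [μ.IsAddHaarMeasure] {K : Set E} (hK : IsClosed K)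
    (hne : K.Nonempty) :
    ∀ᵐ x ∂μ, nearestPoint K x ∈ K ∧ ‖x - nearestPoint K x‖ = Metric.infDist x K := by
  filter_upwards [(Metric.lipschitz_infDist_pt K).ae_differentiableAt (μ := μ)] with x hx
  obtain ⟨p, hp, hxp⟩ := hK.exists_infDist_eq_dist hne x
  have h : nearestPoint K x = p := by
    rw [nearestPoint, infDist_smul_gradient_infDist hp hxp hx, sub_sub_cancel]
  rw [h, hxp, dist_eq_norm]
  exact ⟨hp, rfl⟩

open scoped Convolution in
/-- Mollification at scale `ε` keeps the Lipschitz constant, moves the values of a 1-Lipschitz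
function by at most `ε`, and depends only on the values in a ball of radius `ε`. -/
theorem exists_contDiff_lipschitz_near (μ : Measure E) [μ.IsAddHaarMeasure] {g : E → ℝ}
    (hg : LipschitzWith 1 g) {ε : ℝ} (hε : 0 < ε) :
    ∃ ψ : E → ℝ, ContDiff ℝ 1 ψ ∧ LipschitzWith 1 ψ ∧ (∀ x, |ψ x - g x| ≤ ε) ∧
      ∀ x, (∀ y ∈ Metric.ball x ε, g y = 0) → ψ x = 0 := by
  let φ : ContDiffBump (0 : E) := ⟨ε / 2, ε, by positivity, by linarith⟩
  have hint : ∀ x, Integrable (fun t => φ.normed μ t • g (x - t)) μ := fun x =>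
    ((φ.continuous_normed).smul (hg.continuous.comp (continuous_const.sub
      continuous_id))).integrable_of_hasCompactSupport φ.hasCompactSupport_normed.smul_right
  refine ⟨(φ.normed μ) ⋆[ContinuousLinearMap.lsmul ℝ ℝ, μ] g, ?_, ?_, ?_, ?_⟩
  · exact φ.hasCompactSupport_normed.contDiff_convolution_left _ φ.contDiff_normed
      hg.continuous.locallyIntegrable
  · refine LipschitzWith.of_dist_le_mul fun x y => ?_
    simp only [convolution, ContinuousLinearMap.lsmul_apply, NNReal.coe_one, one_mul]
    rw [dist_eq_norm, ← integral_sub (hint x) (hint y)]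
    calc _ ≤ ∫ t, φ.normed μ t * dist x y ∂μ := by
          refine norm_integral_le_of_norm_le (φ.integrable_normed.mul_const _) ?_
          refine Filter.Eventually.of_forall fun t => ?_
          rw [← smul_sub, norm_smul, Real.norm_of_nonneg (φ.nonneg_normed t), ← dist_eq_norm]
          refine mul_le_mul_of_nonneg_left ?_ (φ.nonneg_normed t)
          simpa using hg.dist_le_mul (x - t) (y - t)
      _ = dist x y := by rw [integral_mul_const, φ.integral_normed, one_mul]
  · intro x
    rw [← Real.dist_eq]
    refine φ.dist_normed_convolution_le hg.continuous.aestronglyMeasurable fun y hy => ?_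
    simpa using (hg.dist_le_mul y x).trans (by simpa using (Metric.mem_ball.1 hy).le)
  · intro x hx
    have h0 := hx x (Metric.mem_ball_self hε)
    rw [φ.normed_convolution_eq_right fun y hy => (hx y hy).trans h0.symm, h0]

end

/-! ### Integration against vector measures with a density -/

section
variable {X E F G : Type*} [MeasurableSpace X]
  [NormedAddCommGroup E] [NormedSpace ℝ E]
  [NormedAddCommGroup F] [NormedSpace ℝ F] [CompleteSpace F]
  [NormedAddCommGroup G] [NormedSpace ℝ G] [CompleteSpace G]

/-- A density `g` is its norm times a field of unit vectors. The norm gives the total variation,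
which is the measure behind the integrable functions on the left-hand side, so both sides are
continuous in `L¹` of the same measure and agree on indicators. -/
theorem integral_withDensityᵥ_eq_polar {μ : Measure X} {g : X → F} (hg : Integrable g μ)
    (B : E →L[ℝ] F →L[ℝ] G) {h : X → E} (hh : (μ.withDensityᵥ g).Integrable h) :
    (μ.withDensityᵥ g).integral h B =
      ∫ x, B (h x) (‖g x‖⁻¹ • g x) ∂(μ.withDensity fun x => ‖g x‖ₑ) := by
  set ν := μ.withDensity fun x => ‖g x‖ₑ with hν
  have hvar : (μ.withDensityᵥ g).variation = ν := Measure.variation_withDensityᵥ hg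
  have : IsFiniteMeasure ν := ⟨by simpa [hν] using! hg.2⟩
  have : IsFiniteMeasure (μ.withDensityᵥ g).variation := hvar ▸ this
  have hu : AEStronglyMeasurable (fun x => ‖g x‖⁻¹ • g x) ν :=
    (hg.aestronglyMeasurable.norm.inv₀.smul hg.aestronglyMeasurable).mono_ac
      (withDensity_absolutelyContinuous _ _)
  have hu1 : ∀ x, ‖‖g x‖⁻¹ • g x‖ ≤ 1 := fun x => by simp [norm_smul, inv_mul_le_one]
  have hb : ∀ (k : X → E) x, ‖B (k x) (‖g x‖⁻¹ • g x)‖ ≤ ‖B‖ * ‖k x‖ := fun k x =>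
    (B.le_opNorm₂ _ _).trans (mul_le_of_le_one_right (by positivity) (hu1 x))
  have hint : ∀ k : X → E, Integrable k ν → Integrable (fun x => B (k x) (‖g x‖⁻¹ • g x)) ν :=
    fun k hk => (hk.norm.const_mul ‖B‖).mono' (B.aestronglyMeasurable_comp₂ hk.1 hu)
      (Filter.Eventually.of_forall (hb k))
  refine Integrable.induction (μ := (μ.withDensityᵥ g).variation)
    (fun h => (μ.withDensityᵥ g).integral h B = ∫ x, B (h x) (‖g x‖⁻¹ • g x) ∂ν)
    ?_ ?_ ?_ ?_ hh
  · intro c s hs _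
    have h1 : (fun x => B (s.indicator (fun _ => c) x) (‖g x‖⁻¹ • g x)) =
        s.indicator fun x => B c (‖g x‖⁻¹ • g x) := by
      ext x
      by_cases hx : x ∈ s <;> simp [hx]
    have h2 : ∫ x in s, ‖g x‖⁻¹ • g x ∂ν = ∫ x in s, g x ∂μ := by
      rw [setIntegral_withDensity_eq_setIntegral_toReal_smul₀ _ _ _ hs]
      · refine integral_congr_ae (Filter.Eventually.of_forall fun x => ?_)
        rcases eq_or_ne (g x) 0 with hx | hx
        · simp [hx]
        · simp [smul_smul, hx]
      · exact hg.aestronglyMeasurable.restrict.enorm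
      · exact Filter.Eventually.of_forall fun x => by simp
    rw [VectorMeasure.integral_indicator_const _ hs, h1, integral_indicator hs,
      withDensityᵥ_apply hg hs, ← h2]
    refine ((B c).integral_comp_comm ?_).symm
    exact (Integrable.of_bound hu 1 (Filter.Eventually.of_forall hu1)).restrict
  · intro k l _ hk hl hk' hl'
    rw [VectorMeasure.integral_add hk hl, hk', hl', ← integral_add]
    · simp
    · exact hint k (hvar ▸ hk)
    · exact hint l (hvar ▸ hl)
  · have hdist : ∀ k l : X → E, Integrable k (μ.withDensityᵥ g).variation →
        Integrable l (μ.withDensityᵥ g).variation →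
        ‖∫ x, B (k x) (‖g x‖⁻¹ • g x) ∂ν - ∫ x, B (l x) (‖g x‖⁻¹ • g x) ∂ν‖ ≤
          ‖B‖ * ∫ x, dist (k x) (l x) ∂(μ.withDensityᵥ g).variation := by
      intro k l
      rw [hvar]
      intro hk hl
      rw [← integral_sub (hint _ hk) (hint _ hl), ← integral_const_mul]
      refine norm_integral_le_of_norm_le ?_ (Filter.Eventually.of_forall fun x => ?_)
      · simpa only [dist_eq_norm, Pi.sub_apply] using (hk.sub hl).norm.const_mul ‖B‖
      · simpa [dist_eq_norm, smul_sub] using hb (fun x => k x - l x) x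
    refine isClosed_eq VectorMeasure.continuous_integral ?_
    refine LipschitzWith.continuous (K := ‖B‖₊) (LipschitzWith.of_dist_le_mul fun k l => ?_)
    rw [L1.dist_eq_integral_dist, dist_eq_norm]
    exact hdist k l (L1.integrable_coeFn k) (L1.integrable_coeFn l)
  · intro k l hkl _ hk
    rw [← VectorMeasure.integral_congr_ae hkl, hk]
    refine integral_congr_ae ?_
    rw [hvar] at hkl
    filter_upwards [hkl] with x hx using by rw [hx]

theorem integral_withDensityᵥ {μ : Measure X} {g : X → F} (hg : Integrable g μ)
    (B : E →L[ℝ] F →L[ℝ] G) {h : X → E} (hh : (μ.withDensityᵥ g).Integrable h) :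
    (μ.withDensityᵥ g).integral h B = ∫ x, B (h x) (g x) ∂μ := by
  rw [integral_withDensityᵥ_eq_polar hg B hh, integral_withDensity_eq_integral_toReal_smul₀]
  · refine integral_congr_ae (Filter.Eventually.of_forall fun x => ?_)
    rcases eq_or_ne (g x) 0 with hx | hx
    · simp [hx]
    · simp [smul_smul, hx]
  · exact hg.aestronglyMeasurable.enorm
  · exact Filter.Eventually.of_forall fun x => by simp

end

/-! ### The lower bound -/

theorem integrableOn_continuous_mul_of_isBounded {Ω : Set Plane} (hΩo : IsOpen Ω)
    (hΩb : Bornology.IsBounded Ω) {f : Plane → ℝ} (hf : IntegrableOn f Ω) {h : Plane → ℝ}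
    (hh : Continuous h) : IntegrableOn (fun x => h x * f x) Ω :=
  IntegrableOn.continuousOn_mul_of_subset hh.continuousOn hf hΩb.isCompact_closure
    hΩo.measurableSet subset_closure

theorem avgDist_eq_ofReal_integral {Ω : Set Plane} (hΩo : IsOpen Ω)
    (hΩb : Bornology.IsBounded Ω) {f : Plane → ℝ} (hf : IntegrableOn f Ω)
    (hf0 : ∀ᵐ x ∂(volume.restrict Ω), 0 ≤ f x) (K : Set Plane) :
    avgDist Ω f K = ENNReal.ofReal (∫ x in Ω, Metric.infDist x K * f x) := by
  refine (ofReal_integral_eq_lintegral_ofReal (integrableOn_continuous_mul_of_isBounded hΩo hΩb hf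
    (Metric.continuous_infDist_pt K)) ?_).symm
  filter_upwards [hf0] with x hx using mul_nonneg Metric.infDist_nonneg hx

/-- The easy inequality of the duality: mollified truncations of the distance to `K` are admissible
potentials with gradient at most `1`. -/
theorem avgDist_le_variation {Ω : Set Plane} (hΩo : IsOpen Ω)
    (hΩb : Bornology.IsBounded Ω) {f : Plane → ℝ} (hf : IntegrableOn f Ω)
    (hf0 : ∀ᵐ x ∂(volume.restrict Ω), 0 ≤ f x) {K : Set Plane} {v : VectorMeasure Plane Plane}
    (h : (K, v) ∈ admissiblePairs Ω f) : avgDist Ω f K ≤ v.variation (closure Ω) := by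
  obtain ⟨-, ⟨hfin, hsupp⟩, hadm⟩ := h
  have : IsFiniteMeasure v.variation := ⟨hfin⟩
  have huniv : v.variation.real univ = v.variation.real (closure Ω) := by
    rw [measureReal_def, measureReal_def, ← measure_add_measure_compl isClosed_closure.measurableSet,
      hsupp, add_zero]
  rw [avgDist_eq_ofReal_integral hΩo hΩb hf hf0, ENNReal.ofReal_le_iff_le_toReal (by finiteness),
    ← measureReal_def]
  have hstep : ∀ ε > 0, ∫ x in Ω, Metric.infDist x K * f x ≤
      v.variation.real (closure Ω) + ε * (2 * ∫ x in Ω, f x) := by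
    intro ε hε
    -- `(dist(·, K) - ε)⁺` vanishes on a neighbourhood of `K` of width `ε`.
    set g : Plane → ℝ := fun x => max (Metric.infDist x K - ε) 0 with hg
    have hgl : LipschitzWith 1 g := by
      refine LipschitzWith.max_const (LipschitzWith.of_dist_le_mul fun x y => ?_) 0
      simpa using (Metric.lipschitz_infDist_pt K).dist_le_mul x y
    obtain ⟨ψ, hψ, hψl, hψg, hψ0⟩ := exists_contDiff_lipschitz_near volume hgl hε
    have hψK : ∀ x ∈ K, ψ x = 0 := fun x hx => hψ0 x fun y hy => by
      have := Metric.infDist_le_dist_of_mem (x := y) hx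
      have := Metric.mem_ball.1 hy
      exact max_eq_right (by linarith)
    have hpair : gradPairing ψ v ≤ v.variation.real (closure Ω) := by
      have h1 := VectorMeasure.norm_integral_le_of_norm_le_const (μ := v)
        (B := ContinuousLinearMap.id ℝ (Plane →L[ℝ] ℝ)) (f := fun x => fderiv ℝ ψ x) (C := 1)
        (Filter.Eventually.of_forall fun x => by
          simpa using norm_fderiv_le_of_lipschitz ℝ hψl (x₀ := x))
      rw [← huniv]
      refine (le_abs_self _).trans (h1.trans ?_)
      rw [one_mul]
      exact mul_le_of_le_one_left measureReal_nonneg ContinuousLinearMap.norm_id_le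
    have hle : ∫ x in Ω, Metric.infDist x K * f x ≤ ∫ x in Ω, (ψ x * f x + ε * 2 * f x) := by
      refine integral_mono_ae (integrableOn_continuous_mul_of_isBounded hΩo hΩb hf
        (Metric.continuous_infDist_pt K)) ((integrableOn_continuous_mul_of_isBounded hΩo hΩb hf
        hψ.continuous).add (hf.const_mul _)) ?_
      filter_upwards [hf0] with x hx
      rw [← add_mul]
      refine mul_le_mul_of_nonneg_right ?_ hx
      have h1 := (abs_le.1 (hψg x)).1
      have h2 : Metric.infDist x K - ε ≤ g x := le_max_left _ _
      linarith
    rw [integral_add (integrableOn_continuous_mul_of_isBounded hΩo hΩb hf hψ.continuous)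
      (hf.const_mul _), integral_const_mul, ← hadm ψ hψ hψK] at hle
    linarith
  refine le_of_forall_pos_le_add fun δ hδ => ?_
  have hI : 0 ≤ ∫ x in Ω, f x := integral_nonneg_of_ae hf0
  -- The summand `1` keeps the denominator positive when `f` has integral zero.
  refine (hstep (δ / (2 * (∫ x in Ω, f x) + 1)) (by positivity)).trans ?_
  gcongr
  rw [div_mul_eq_mul_div, div_le_iff₀ (by positivity)]
  nlinarith

/-! ### The flow along segments to the nearest points -/

/-- The vector measure that transports the mass `f dx` on `Ω` along straight segments to the
nearest points of `K`, oriented away from `K` since its divergence is `-f`: the push-forward of the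
density `f(x) (x - p(x))` on `Ω × [0, 1]` by `(x, t) ↦ p(x) + t (x - p(x))`. -/
noncomputable def segmentFlow (Ω : Set Plane) (f : Plane → ℝ) (K : Set Plane) :
    VectorMeasure Plane Plane :=
  (((volume.restrict Ω).prod (volume.restrict (Icc (0 : ℝ) 1))).withDensityᵥ
    fun z => f z.1 • (z.1 - nearestPoint K z.1)).map
    fun z => AffineMap.lineMap (nearestPoint K z.1) z.1 z.2

section segmentFlow

variable {Ω : Set Plane} {f : Plane → ℝ} {K : Set Plane}

instance : IsProbabilityMeasure (volume.restrict (Icc (0 : ℝ) 1)) := ⟨by simp⟩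

theorem measurable_segment (K : Set Plane) : Measurable fun z : Plane × ℝ =>
    (AffineMap.lineMap (nearestPoint K z.1) z.1 z.2 : Plane) := by
  have := measurable_nearestPoint K
  simp only [AffineMap.lineMap_apply_module]
  fun_prop

theorem aestronglyMeasurable_displacement (hf : IntegrableOn f Ω) :
    AEStronglyMeasurable (fun x => f x • (x - nearestPoint K x)) (volume.restrict Ω) :=
  hf.aestronglyMeasurable.smul
    (measurable_id.sub (measurable_nearestPoint K)).aestronglyMeasurable

theorem lintegral_enorm_displacement (hf0 : ∀ᵐ x ∂(volume.restrict Ω), 0 ≤ f x)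
    (hK : IsClosed K) (hne : K.Nonempty) :
    ∫⁻ x in Ω, ‖f x • (x - nearestPoint K x)‖ₑ = avgDist Ω f K := by
  refine lintegral_congr_ae ?_
  filter_upwards [hf0, ae_restrict_of_ae (ae_nearestPoint_mem volume hK hne)] with x hx hp
  rw [← ofReal_norm, norm_smul, hp.2, Real.norm_of_nonneg hx, mul_comm]

theorem integrableOn_displacement (hΩo : IsOpen Ω) (hΩb : Bornology.IsBounded Ω)
    (hf : IntegrableOn f Ω) (hf0 : ∀ᵐ x ∂(volume.restrict Ω), 0 ≤ f x) (hK : IsClosed K)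
    (hne : K.Nonempty) : IntegrableOn (fun x => f x • (x - nearestPoint K x)) Ω := by
  refine ⟨aestronglyMeasurable_displacement hf, ?_⟩
  rw [hasFiniteIntegral_iff_enorm, lintegral_enorm_displacement hf0 hK hne,
    avgDist_eq_ofReal_integral hΩo hΩb hf hf0]
  exact ENNReal.ofReal_lt_top

theorem ae_segment_mem_closure (hΩo : IsOpen Ω) (hΩc : Convex ℝ (closure Ω)) (hK : IsClosed K)
    (hne : K.Nonempty) (hKΩ : K ⊆ closure Ω) :
    ∀ᵐ z ∂((volume.restrict Ω).prod (volume.restrict (Icc (0 : ℝ) 1))),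
      (AffineMap.lineMap (nearestPoint K z.1) z.1 z.2 : Plane) ∈ closure Ω := by
  filter_upwards [Measure.quasiMeasurePreserving_fst.ae (ae_restrict_mem hΩo.measurableSet),
    Measure.quasiMeasurePreserving_fst.ae
      (ae_restrict_of_ae (s := Ω) (ae_nearestPoint_mem volume hK hne)),
    Measure.quasiMeasurePreserving_snd.ae (ae_restrict_mem measurableSet_Icc)] with z h1 h2 h3
  exact hΩc.lineMap_mem (hKΩ h2.1) (subset_closure h1) h3

theorem integrable_displacement_prod (hΩo : IsOpen Ω) (hΩb : Bornology.IsBounded Ω)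
    (hf : IntegrableOn f Ω) (hf0 : ∀ᵐ x ∂(volume.restrict Ω), 0 ≤ f x) (hK : IsClosed K)
    (hne : K.Nonempty) :
    Integrable (fun z : Plane × ℝ => f z.1 • (z.1 - nearestPoint K z.1))
      ((volume.restrict Ω).prod (volume.restrict (Icc (0 : ℝ) 1))) :=
  (integrableOn_displacement hΩo hΩb hf hf0 hK hne).comp_fst _

theorem variation_segmentFlow_le (hΩo : IsOpen Ω) (hΩb : Bornology.IsBounded Ω)
    (hf : IntegrableOn f Ω) (hf0 : ∀ᵐ x ∂(volume.restrict Ω), 0 ≤ f x) (hK : IsClosed K)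
    (hne : K.Nonempty) {s : Set Plane} (hs : MeasurableSet s) :
    (segmentFlow Ω f K).variation s ≤
      ∫⁻ z in (fun z : Plane × ℝ => (AffineMap.lineMap (nearestPoint K z.1) z.1 z.2 : Plane)) ⁻¹' s,
        ‖f z.1 • (z.1 - nearestPoint K z.1)‖ₑ
        ∂((volume.restrict Ω).prod (volume.restrict (Icc (0 : ℝ) 1))) := by
  refine (VectorMeasure.variation_map_le s).trans ?_
  rw [Measure.map_apply (measurable_segment K) hs, Measure.variation_withDensityᵥ
    (integrable_displacement_prod hΩo hΩb hf hf0 hK hne),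
    withDensity_apply _ (measurable_segment K hs)]

theorem variation_segmentFlow_univ_le (hΩo : IsOpen Ω) (hΩb : Bornology.IsBounded Ω)
    (hf : IntegrableOn f Ω) (hf0 : ∀ᵐ x ∂(volume.restrict Ω), 0 ≤ f x) (hK : IsClosed K)
    (hne : K.Nonempty) : (segmentFlow Ω f K).variation univ ≤ avgDist Ω f K := by
  refine (variation_segmentFlow_le hΩo hΩb hf hf0 hK hne MeasurableSet.univ).trans_eq ?_
  rw [preimage_univ, Measure.restrict_univ, lintegral_prod _
    (integrable_displacement_prod hΩo hΩb hf hf0 hK hne).aestronglyMeasurable.enorm]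
  simp only [lintegral_const, measure_univ, mul_one]
  exact lintegral_enorm_displacement hf0 hK hne

theorem variation_segmentFlow_compl_closure (hΩo : IsOpen Ω) (hΩb : Bornology.IsBounded Ω)
    (hΩc : Convex ℝ (closure Ω)) (hf : IntegrableOn f Ω)
    (hf0 : ∀ᵐ x ∂(volume.restrict Ω), 0 ≤ f x) (hK : IsClosed K)
    (hne : K.Nonempty) (hKΩ : K ⊆ closure Ω) :
    (segmentFlow Ω f K).variation (closure Ω)ᶜ = 0 := by
  refine le_antisymm ((variation_segmentFlow_le hΩo hΩb hf hf0 hK hne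
    isClosed_closure.measurableSet.compl).trans_eq (setLIntegral_measure_zero _ _ ?_)) zero_le
  exact ae_segment_mem_closure hΩo hΩc hK hne hKΩ

theorem integral_fderiv_lineMap {E : Type*} [NormedAddCommGroup E] [NormedSpace ℝ E] {ψ : E → ℝ}
    (hψ : ContDiff ℝ 1 ψ) (p x : E) :
    ∫ t in Icc (0 : ℝ) 1, fderiv ℝ ψ (AffineMap.lineMap p x t) (x - p) = ψ x - ψ p := by
  have hderiv : ∀ t : ℝ, HasDerivAt (fun t => ψ (AffineMap.lineMap p x t))
      (fderiv ℝ ψ (AffineMap.lineMap p x t) (x - p)) t := fun t =>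
    ((hψ.differentiable one_ne_zero _).hasFDerivAt.comp_hasDerivAt t AffineMap.hasDerivAt_lineMap)
  have hcont : Continuous fun t : ℝ => fderiv ℝ ψ (AffineMap.lineMap p x t) (x - p) :=
    ((hψ.continuous_fderiv one_ne_zero).comp AffineMap.lineMap_continuous).clm_apply
      continuous_const
  rw [integral_Icc_eq_integral_Ioc, ← intervalIntegral.integral_of_le zero_le_one,
    intervalIntegral.integral_eq_sub_of_hasDerivAt (fun t _ => hderiv t)
      (hcont.intervalIntegrable _ _)]
  simp

/-- On the segment of each point `x`, the fundamental theorem of calculus gives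
`f(x) (ψ(x) - ψ(p(x)))`, and `ψ(p(x)) = 0`. -/
theorem gradPairing_segmentFlow (hΩo : IsOpen Ω) (hΩb : Bornology.IsBounded Ω)
    (hΩc : Convex ℝ (closure Ω)) (hf : IntegrableOn f Ω)
    (hf0 : ∀ᵐ x ∂(volume.restrict Ω), 0 ≤ f x) (hK : IsClosed K)
    (hne : K.Nonempty) (hKΩ : K ⊆ closure Ω) {ψ : Plane → ℝ} (hψ : ContDiff ℝ 1 ψ)
    (hψK : ∀ x ∈ K, ψ x = 0) :
    gradPairing ψ (segmentFlow Ω f K) = ∫ x in Ω, ψ x * f x := by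
  set ρ := (volume.restrict Ω).prod (volume.restrict (Icc (0 : ℝ) 1)) with hρ
  set γ : Plane × ℝ → Plane := fun z => AffineMap.lineMap (nearestPoint K z.1) z.1 z.2 with hγ
  set g : Plane × ℝ → Plane := fun z => f z.1 • (z.1 - nearestPoint K z.1) with hg
  have hgi : Integrable g ρ := integrable_displacement_prod hΩo hΩb hf hf0 hK hne
  have hγm : Measurable γ := measurable_segment K
  have hcont : Continuous (fderiv ℝ ψ) := hψ.continuous_fderiv one_ne_zero
  obtain ⟨C, hC⟩ := hΩb.isCompact_closure.exists_bound_of_continuousOn hcont.continuousOn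
  have hγC : ∀ᵐ z ∂ρ, ‖fderiv ℝ ψ (γ z)‖ ≤ C := by
    filter_upwards [ae_segment_mem_closure hΩo hΩc hK hne hKΩ] with z hz using hC _ hz
  have hvar : (ρ.withDensityᵥ g).variation = ρ.withDensity fun z => ‖g z‖ₑ :=
    Measure.variation_withDensityᵥ hgi
  have : IsFiniteMeasure (ρ.withDensityᵥ g).variation := ⟨by simpa [hvar] using! hgi.2⟩
  have hcm : Measurable fun z => fderiv ℝ ψ (γ z) := hcont.measurable.comp hγm
  have hint : (ρ.withDensityᵥ g).Integrable fun z => fderiv ℝ ψ (γ z) := by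
    refine Integrable.of_bound hcm.aestronglyMeasurable C ?_
    rw [hvar]
    exact (withDensity_absolutelyContinuous _ _).ae_le hγC
  have hpair : gradPairing ψ (segmentFlow Ω f K) = ∫ z, fderiv ℝ ψ (γ z) (g z) ∂ρ := by
    rw [gradPairing, segmentFlow,
      VectorMeasure.integral_map hγm hcont.aestronglyMeasurable hint,
      integral_withDensityᵥ hgi _ hint]
    rfl
  have hprod : Integrable (fun z => fderiv ℝ ψ (γ z) (g z)) ρ := by
    refine (hgi.norm.const_mul C).mono' ?_ ?_
    · exact (ContinuousLinearMap.id ℝ (Plane →L[ℝ] ℝ)).aestronglyMeasurable_comp₂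
        hcm.aestronglyMeasurable hgi.1
    · filter_upwards [hγC] with z hz
      exact (ContinuousLinearMap.le_opNorm _ _).trans
        (mul_le_mul_of_nonneg_right hz (norm_nonneg _))
  rw [hpair, integral_prod _ hprod]
  refine integral_congr_ae ?_
  filter_upwards [ae_restrict_of_ae (s := Ω) (ae_nearestPoint_mem volume hK hne)] with x hx
  simp only [hγ, hg, map_smul, smul_eq_mul, integral_const_mul]
  rw [integral_fderiv_lineMap hψ, hψK _ hx.1, sub_zero, mul_comm]

theorem segmentFlow_mem_admissiblePairs (hΩo : IsOpen Ω) (hΩb : Bornology.IsBounded Ω)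
    (hΩc : Convex ℝ (closure Ω)) (hf : IntegrableOn f Ω)
    (hf0 : ∀ᵐ x ∂(volume.restrict Ω), 0 ≤ f x) (hK : K ∈ competitors Ω) :
    (K, segmentFlow Ω f K) ∈ admissiblePairs Ω f := by
  obtain ⟨hKΩ, hKc, hKn⟩ := hK
  refine ⟨⟨hKΩ, hKc, hKn⟩, ⟨?_, ?_⟩, fun ψ hψ hψK => ?_⟩
  · refine (variation_segmentFlow_univ_le hΩo hΩb hf hf0 hKc hKn.nonempty).trans_lt ?_
    rw [avgDist_eq_ofReal_integral hΩo hΩb hf hf0]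
    exact ENNReal.ofReal_lt_top
  · exact variation_segmentFlow_compl_closure hΩo hΩb hΩc hf hf0 hKc hKn.nonempty hKΩ
  · exact gradPairing_segmentFlow hΩo hΩb hΩc hf hf0 hKc hKn.nonempty hKΩ hψ hψK

theorem isLeast_variation_avgDist (hΩo : IsOpen Ω) (hΩb : Bornology.IsBounded Ω)
    (hΩc : Convex ℝ (closure Ω)) (hf : IntegrableOn f Ω)
    (hf0 : ∀ᵐ x ∂(volume.restrict Ω), 0 ≤ f x) (hK : K ∈ competitors Ω) :
    IsLeast {m : ENNReal | ∃ v, (K, v) ∈ admissiblePairs Ω f ∧ v.variation (closure Ω) = m}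
      (avgDist Ω f K) := by
  have hadm := segmentFlow_mem_admissiblePairs hΩo hΩb hΩc hf hf0 hK
  refine ⟨⟨_, hadm, le_antisymm ((measure_mono (subset_univ _)).trans ?_)
    (avgDist_le_variation hΩo hΩb hf hf0 hadm)⟩, ?_⟩
  · exact variation_segmentFlow_univ_le hΩo hΩb hf hf0 hK.2.1 hK.2.2.nonempty
  · rintro _ ⟨v, hv, rfl⟩
    exact avgDist_le_variation hΩo hΩb hf hf0 hv

end segmentFlow

/-- Singletons are competitors of finite energy. -/
theorem hausdorffMeasure_lt_top_of_isMinimizerOn {Ω : Set Plane} (hΩo : IsOpen Ω)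
    (hΩb : Bornology.IsBounded Ω) {f : Plane → ℝ} (hf : IntegrableOn f Ω)
    (hf0 : ∀ᵐ x ∂(volume.restrict Ω), 0 ≤ f x) {Λ : ℝ} {K : Set Plane}
    (hK : IsMinimizerOn (avgDistEnergy Ω f Λ) (competitors Ω) K) :
    ENNReal.ofReal Λ * Measure.hausdorffMeasure 1 K < ⊤ := by
  obtain ⟨⟨hKΩ, -, hKn⟩, hmin⟩ := hK
  obtain ⟨x, hx⟩ := hKn.nonempty
  have hle := hmin {x} ⟨singleton_subset_iff.2 (hKΩ hx), isClosed_singleton, isConnected_singleton⟩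
  have h0 : Measure.hausdorffMeasure 1 ({x} : Set Plane) = 0 :=
    (Measure.nullSingletonClass_hausdorff Plane one_pos).measure_singleton x
  refine (le_add_self.trans hle).trans_lt ?_
  rw [avgDistEnergy, h0, mul_zero, add_zero, avgDist_eq_ofReal_integral hΩo hΩb hf hf0]
  exact ENNReal.ofReal_lt_top

/-! ### Equivalence of the two problems -/

theorem mainTheorem7 (Ω : Set Plane) (hΩo : IsOpen Ω) (hΩb : Bornology.IsBounded Ω)
    (hΩc : Convex ℝ (closure Ω)) (f : Plane → ℝ) (hf : IntegrableOn f Ω)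
    (hf0 : ∀ᵐ x ∂(volume.restrict Ω), 0 ≤ f x) (Λ : ℝ) (hΛ : 0 < Λ) :
    (∀ K ∈ competitors Ω,
      IsLeast {m : ENNReal | ∃ v, (K, v) ∈ admissiblePairs Ω f ∧ v.variation (closure Ω) = m}
        (avgDist Ω f K)) ∧
    (⨅ K ∈ competitors Ω, avgDistEnergy Ω f Λ K) =
      (⨅ p ∈ admissiblePairs Ω f, beckmannEnergy Ω Λ p) ∧
    (∀ K : Set Plane,
      IsMinimizerOn (avgDistEnergy Ω f Λ) (competitors Ω) K ↔
        ∃ v, IsMinimizerOn (beckmannEnergy Ω Λ) (admissiblePairs Ω f) (K, v)) ∧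
    (∀ (K : Set Plane) (v : VectorMeasure Plane Plane),
      IsMinimizerOn (beckmannEnergy Ω Λ) (admissiblePairs Ω f) (K, v) ↔
        IsMinimizerOn (avgDistEnergy Ω f Λ) (competitors Ω) K ∧
          (K, v) ∈ admissiblePairs Ω f ∧ v.variation (closure Ω) = avgDist Ω f K) := by
  have hleast := fun K (hK : K ∈ competitors Ω) =>
    isLeast_variation_avgDist hΩo hΩb hΩc hf hf0 hK
  have hle : ∀ p ∈ admissiblePairs Ω f, avgDistEnergy Ω f Λ p.1 ≤ beckmannEnergy Ω Λ p :=
    fun p hp => add_le_add_left ((hleast p.1 hp.1).2 ⟨p.2, hp, rfl⟩) _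
  have hex : ∀ K ∈ competitors Ω, ∃ v, (K, v) ∈ admissiblePairs Ω f ∧
      v.variation (closure Ω) = avgDist Ω f K ∧
      beckmannEnergy Ω Λ (K, v) = avgDistEnergy Ω f Λ K := by
    intro K hK
    obtain ⟨v, hv, hvK⟩ := (hleast K hK).1
    exact ⟨v, hv, hvK, by rw [beckmannEnergy, avgDistEnergy, hvK]⟩
  have hiff : ∀ (K : Set Plane) (v : VectorMeasure Plane Plane),
      IsMinimizerOn (beckmannEnergy Ω Λ) (admissiblePairs Ω f) (K, v) ↔
        IsMinimizerOn (avgDistEnergy Ω f Λ) (competitors Ω) K ∧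
          (K, v) ∈ admissiblePairs Ω f ∧ v.variation (closure Ω) = avgDist Ω f K := by
    intro K v
    constructor
    · rintro ⟨hv, hmin⟩
      have hK : IsMinimizerOn (avgDistEnergy Ω f Λ) (competitors Ω) K := by
        refine ⟨hv.1, fun L hL => ?_⟩
        obtain ⟨w, hw, -, hwL⟩ := hex L hL
        exact (hle _ hv).trans ((hmin _ hw).trans_eq hwL)
      -- The length term is finite at a minimizer, so it cancels from the comparison of `v` with an
      -- optimal measure for the same set.
      refine ⟨hK, hv, le_antisymm ?_ ((hleast K hv.1).2 ⟨v, hv, rfl⟩)⟩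
      obtain ⟨w, hw, -, hwK⟩ := hex K hv.1
      exact (ENNReal.add_le_add_iff_right
        (hausdorffMeasure_lt_top_of_isMinimizerOn hΩo hΩb hf hf0 hK).ne).1
        ((hmin _ hw).trans_eq hwK)
    · rintro ⟨⟨-, hmin⟩, hv, hvK⟩
      refine ⟨hv, fun p hp => ?_⟩
      calc beckmannEnergy Ω Λ (K, v) = avgDistEnergy Ω f Λ K := by
            rw [beckmannEnergy, avgDistEnergy, hvK]
        _ ≤ avgDistEnergy Ω f Λ p.1 := hmin _ hp.1
        _ ≤ beckmannEnergy Ω Λ p := hle p hp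
  refine ⟨hleast, le_antisymm ?_ ?_, fun K => ⟨fun hK => ?_, ?_⟩, hiff⟩
  · exact le_iInf₂ fun p hp => (iInf₂_le p.1 hp.1).trans (hle p hp)
  · refine le_iInf₂ fun K hK => ?_
    obtain ⟨v, hv, -, hvK⟩ := hex K hK
    exact (iInf₂_le _ hv).trans_eq hvK
  · obtain ⟨v, hv, hvK, -⟩ := hex K hK.1
    exact ⟨v, (hiff K v).2 ⟨hK, hv, hvK⟩⟩
  · rintro ⟨v, hv⟩
    exact ((hiff K v).1 hv).1
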